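/- A CNF is a finite set of clauses, each clause being a finite set of literals that contains no variable together with its negation; its variables are those occurring in its clauses. The primal graph of a CNF has the variables as vertices, two distinct variables being adjacent if and only if some clause contains both. The OBDD size of a CNF $F$ is the smallest number of nodes (internal nodes and the two leaves) of an ordered binary decision diagram computing $F$, over all orders of the variables. There is a function $f:\mathbb N\to(0,\infty)$ such that for every integer $p\ge 1$ there is an infinite sequence of CNFs $F_1,F_2,\dots$, with strictly increasing numbers of variables, such that for every $i$ the primal graph of $F_i$ has treewidth at most $p$ and the OBDD size of $F_i$ is at least $f(p)\cdot m_i^{p/4}$, where $m_i$ is the number of variables of $F_i$. In particular, for each fixed $p$, the OBDD size of $F_i$ is $\Omega(m_i^{p/4})$ as $i\to\infty$. Consequently no fixed-parameter bound exists: there are no function $g:\mathbb N\to\mathbb R$ and constant $c\in\mathbb R$ such that every CNF with $m\ge 1$ variables and primal graph of treewidth $k$ has OBDD size at most $g(k)\cdot m^{c}$. -/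

import Mathlib

/-! ### Conjunctive normal forms and their primal graphs -/

/-- A CNF over the supply `V` of variable names: a finite set of clauses, each clause a finite set of
literals. The literal `(x, true)` is `x` and `(x, false)` is `¬ x`. No clause contains a variable
together with its negation. -/
structure CNF (V : Type) where
  clauses : Finset (Finset (V × Bool))
  consistent : ∀ C ∈ clauses, ∀ x : V, ¬ ((x, true) ∈ C ∧ (x, false) ∈ C)

namespace CNF

variable {V : Type} [DecidableEq V]

/-- `Var(F)`: the variables that occur in the clauses of `F`. -/
def vars (F : CNF V) : Finset V :=
  F.clauses.biUnion fun C => C.image Prod.fst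

/-- The number of variables of `F`. -/
def numVars (F : CNF V) : ℕ := F.vars.card

/-- The truth assignment `a` to `Var(F)` satisfies `F`: each clause contains a literal `(x, a x)`. -/
def Sat (F : CNF V) (a : F.vars → Bool) : Prop :=
  ∀ C ∈ F.clauses, ∃ x : F.vars, ((x : V), a x) ∈ C

/-- The primal graph of `F`: its vertices are the variables of `F`, and two of them are adjacent
when some clause contains (a literal of) both. -/
def primalGraph (F : CNF V) : SimpleGraph F.vars where
  Adj x y := x ≠ y ∧ ∃ C ∈ F.clauses, (∃ b, ((x : V), b) ∈ C) ∧ (∃ b, ((y : V), b) ∈ C)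
  symm := ⟨fun _ _ h => ⟨h.1.symm, let ⟨C, hC, hx, hy⟩ := h.2; ⟨C, hC, hy, hx⟩⟩⟩
  loopless := ⟨fun _ h => h.1 rfl⟩

end CNF

/-! ### Treewidth -/

/-- A tree decomposition of the graph `G`, over a finite tree. -/
structure TreeDecomposition {W : Type} (G : SimpleGraph W) where
  Idx : Type
  fintypeIdx : Fintype Idx
  tree : SimpleGraph Idx
  isTree : tree.IsTree
  bag : Idx → Finset W
  union : ∀ v : W, ∃ t, v ∈ bag t
  containment : ∀ u v : W, G.Adj u v → ∃ t, u ∈ bag t ∧ v ∈ bag t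
  connectedness : ∀ v : W, (tree.induce {t | v ∈ bag t}).Connected

/-- The size of the largest bag minus one (`0` if all the bags are empty, which happens only for the
graph without vertices). -/
def TreeDecomposition.width {W : Type} {G : SimpleGraph W} (D : TreeDecomposition G) : ℕ :=
  (@Finset.univ D.Idx D.fintypeIdx).sup (fun t => (D.bag t).card) - 1

/-- The treewidth of a finite graph: the smallest width of a tree decomposition. -/
noncomputable def treewidth {W : Type} (G : SimpleGraph W) : ℕ :=
  sInf {w | ∃ D : TreeDecomposition G, D.width = w}

/-- Every finite graph has a tree decomposition, so the infimum in `treewidth` is attained. -/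
theorem exists_treeDecomposition {W : Type} [Fintype W] (G : SimpleGraph W) :
    Nonempty (TreeDecomposition G) := by
  refine ⟨⟨Unit, inferInstance, ⊥, ?_, fun _ => Finset.univ, fun _ => ⟨(), Finset.mem_univ _⟩,
    fun _ _ _ => ⟨(), Finset.mem_univ _, Finset.mem_univ _⟩, fun v => ?_⟩⟩
  · exact SimpleGraph.IsTree.of_subsingleton
  · have : Nonempty {t : Unit | v ∈ (Finset.univ : Finset W)} := ⟨⟨(), Finset.mem_univ _⟩⟩
    exact SimpleGraph.Connected.of_subsingleton

/-! ### Ordered binary decision diagrams -/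

/-- An OBDD over the finite set `X` of variables. `Node` is the set of internal nodes; the two leaves
are `Sum.inr true` and `Sum.inr false`. An internal node `n` is labelled by the variable `label n` and
has the two leaving edges `n → child n true` and `n → child n false`. The variables along every path
occur in the order of the fixed permutation `order` of `X`, each at most once (a path may skip
variables), which makes the graph acyclic. All internal nodes are reachable from the root. -/
structure OBDD (X : Type) [Fintype X] where
  Node : Type
  finiteNode : Finite Node
  order : X ≃ Fin (Fintype.card X)
  label : Node → X
  child : Node → Bool → Node ⊕ Bool
  root : Node ⊕ Bool
  ordered : ∀ (n n' : Node) (b : Bool),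
    child n b = Sum.inl n' → order (label n) < order (label n')
  rooted : ∀ n : Node,
    Relation.ReflTransGen (fun u v => ∃ n b, u = Sum.inl n ∧ v = child n b) root (Sum.inl n)

namespace OBDD

variable {X : Type} [Fintype X]

/-- The number of nodes of `Z`: the internal nodes and the two leaves. -/
noncomputable def size (Z : OBDD X) : ℕ := Nat.card Z.Node + 2

/-- The edge from `u` to `v` exists and is consistent with the assignment `a`. -/
def Step (Z : OBDD X) (a : X → Bool) (u v : Z.Node ⊕ Bool) : Prop :=
  ∃ n, u = Sum.inl n ∧ v = Z.child n (a (Z.label n))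

/-- The computational path of `a` from the root ends at the leaf `true`. -/
def Accepts (Z : OBDD X) (a : X → Bool) : Prop :=
  Relation.ReflTransGen (Z.Step a) Z.root (Sum.inr true)

end OBDD

namespace CNF

variable {V : Type} [DecidableEq V]

/-- `Z` is an OBDD computing `F`. -/
def ComputedBy (F : CNF V) (Z : OBDD F.vars) : Prop :=
  ∀ a, Z.Accepts a ↔ F.Sat a

/-- The OBDD size of `F`: the smallest size of an OBDD computing `F`, over all the variable orders. -/
noncomputable def obddSize (F : CNF V) : ℕ :=
  sInf {s | ∃ Z : OBDD F.vars, F.ComputedBy Z ∧ Z.size = s}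

end CNF

/-- Every Boolean function is computed by an OBDD (a complete decision tree with merged leaves). -/
theorem exists_obdd {X : Type} [Fintype X] (g : (X → Bool) → Prop) :
    ∃ Z : OBDD X, ∀ a, Z.Accepts a ↔ g a := by
  classical
  set N := Fintype.card X with hN
  let e : X ≃ Fin N := Fintype.equivFin X
  let node : List Bool → {l : List Bool // l.length < N} ⊕ Bool := fun l =>
    if h : l.length < N then Sum.inl ⟨l, h⟩
    else Sum.inr (decide (g fun x => l.getD (e x : ℕ) false))
  let Z : OBDD X :=
    { Node := {l : List Bool // l.length < N}
      finiteNode := (List.finite_length_lt Bool N).to_subtype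
      order := e
      label := fun l => e.symm ⟨l.1.length, l.2⟩
      child := fun l b => node (l.1 ++ [b])
      root := node []
      ordered := by
        rintro ⟨l, hl⟩ ⟨l', hl'⟩ b h
        simp only [node] at h
        split_ifs at h with h1
        simp only [Sum.inl.injEq, Subtype.mk.injEq] at h
        subst h
        simp [Fin.lt_def]
      rooted := by
        rintro ⟨l, hl⟩
        induction l using List.reverseRecOn with
        | nil => simp only [node, dif_pos hl]; exact .refl
        | append_singleton l b ih =>
          have hl' : l.length < N := by simp at hl; omega
          refine (ih hl').tail ⟨⟨l, hl'⟩, b, rfl, ?_⟩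
          simp only [node, dif_pos hl] }
  refine ⟨Z, fun a => ?_⟩
  let full : List Bool := List.ofFn fun i => a (e.symm i)
  have hfull : full.length = N := by simp [full]
  have key : ∀ k, k ≤ N → Relation.ReflTransGen (Z.Step a) Z.root (node (full.take k)) := by
    intro k
    induction k with
    | zero => intro _; simp only [List.take_zero]; exact .refl
    | succ k ih =>
      intro hk
      have hlen : (full.take k).length = k := by simp [hfull]; omega
      have hlt : (full.take k).length < N := by omega
      refine (ih (by omega)).tail ⟨⟨full.take k, hlt⟩, by simp only [node, dif_pos hlt], ?_⟩
      change node _ = node (full.take k ++ [a (e.symm ⟨(full.take k).length, hlt⟩)])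
      congr 1
      rw [List.take_succ_eq_append_getElem (by omega)]
      congr 2
      simp only [full, List.getElem_ofFn]
      congr 2
      exact Fin.ext hlen.symm
  have hend := key N le_rfl
  have hleaf : node (full.take N) = Sum.inr (decide (g a)) := by
    have h0 : full.take N = full := by rw [← hfull]; exact List.take_length
    rw [h0]
    simp only [node, hfull, lt_irrefl, dif_neg, not_false_eq_true]
    congr 3
    funext x
    have hx : (e x : ℕ) < full.length := by rw [hfull]; exact (e x).2
    rw [List.getD_eq_getElem _ _ hx]
    simp [full]
  rw [hleaf] at hend
  constructor
  · intro h
    have hu : Relator.RightUnique (Z.Step a) := by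
      rintro u v w ⟨n, rfl, rfl⟩ ⟨m, hm, rfl⟩
      cases hm
      rfl
    have hstuck : ∀ b v, Relation.ReflTransGen (Z.Step a) (Sum.inr b) v → v = Sum.inr b := by
      intro b v hv
      rcases hv.cases_head with h | ⟨_, ⟨n, hn, _⟩, _⟩
      · exact h.symm
      · cases hn
    rcases Relation.ReflTransGen.total_of_right_unique hu h hend with h | h
    · have := hstuck _ _ h
      simpa using this
    · have := hstuck _ _ h
      simp only [Sum.inr.injEq] at this
      simpa using this.symm
  · intro h
    simpa [OBDD.Accepts, h] using hend

/-- Every CNF is computed by an OBDD, so the infimum in `CNF.obddSize` is attained. -/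
theorem CNF.exists_computedBy {V : Type} [DecidableEq V] (F : CNF V) :
    ∃ Z : OBDD F.vars, F.ComputedBy Z :=
  exists_obdd F.Sat

/-! Take a graph and, for each edge `uv`, the clause `u ∨ v ∨ z` with a private guard `z`. If some
prefix of the variable order is crossed by a matching of size `s`, setting the guards off the
matching to true leaves `s` independent disjunctions, each with one endpoint read early and the
other late. The OBDD must remember which early endpoints are true, so it has at least `2 ^ s` nodes
(`card_le_size_of_fooling`, `two_pow_le_obddSize_guardedCNF`).

The graph is a ternary tree with each node replaced by a column of `k` vertices, all pairs within a
column or between a column and its parent being joined. Bags of two adjacent columns give treewidth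
at most `max (2 * k - 1) 2`. Every order has a prefix crossed by a matching of size `k * H`
(`exists_isCrossMatching_treeEdges`): each of `H` levels contributes `k` edges through a median
argument (`hasBalancedCut_of_children`), and about `log (k * H)` further levels start the induction
(`hasBalancedCut_zero_or`).

There are at most `216 * k ^ 3 * 4 ^ H` variables, while the size is at least `2 ^ (k * H) = (4 ^ H)
^ (k / 2)`. With `k = ⌊(p + 1) / 2⌋` this is of order at least `m ^ (p / 4)` for `p ≥ 2`. For `p =
1`, conjunctions of variables suffice. A fixed-parameter bound fails on taking `p > 4 * c`. -/

/-! ### Lower bounds on the size of an OBDD -/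

namespace OBDD

variable {X : Type} [Fintype X]

/-- The part of `Step` that leaves nodes whose variables are among the first `τ`. -/
def StepBelow (Z : OBDD X) (τ : ℕ) (a : X → Bool) (u v : Z.Node ⊕ Bool) : Prop :=
  ∃ n, u = Sum.inl n ∧ (Z.order (Z.label n) : ℕ) < τ ∧ v = Z.child n (a (Z.label n))

/-- `v` is a leaf or is labelled by a variable that is not among the first `τ`. -/
def IsFrontier (Z : OBDD X) (τ : ℕ) (v : Z.Node ⊕ Bool) : Prop :=
  ∀ n, v = Sum.inl n → τ ≤ (Z.order (Z.label n) : ℕ)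

theorem step_rightUnique (Z : OBDD X) (a : X → Bool) : Relator.RightUnique (Z.Step a) := by
  rintro u v w ⟨n, rfl, rfl⟩ ⟨m, hm, rfl⟩
  cases hm
  rfl

theorem exists_frontier (Z : OBDD X) (τ : ℕ) (a : X → Bool) (u : Z.Node ⊕ Bool) :
    ∃ v, Relation.ReflTransGen (Z.StepBelow τ a) u v ∧ Z.IsFrontier τ v := by
  have key : ∀ (d : ℕ) (n : Z.Node), Fintype.card X - (Z.order (Z.label n) : ℕ) ≤ d →
      ∃ v, Relation.ReflTransGen (Z.StepBelow τ a) (Sum.inl n) v ∧ Z.IsFrontier τ v := by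
    intro d
    induction d with
    | zero => intro n hn; have := (Z.order (Z.label n)).2; omega
    | succ d ih =>
      intro n hn
      by_cases hτ : (Z.order (Z.label n) : ℕ) < τ
      · have hs : Z.StepBelow τ a (Sum.inl n) (Z.child n (a (Z.label n))) := ⟨n, rfl, hτ, rfl⟩
        rcases hc : Z.child n (a (Z.label n)) with n' | b
        · have hlt : (Z.order (Z.label n) : ℕ) < Z.order (Z.label n') := Z.ordered n n' _ hc
          obtain ⟨v, hv, hf⟩ := ih n' (by omega)
          exact ⟨v, .head (hc ▸ hs) hv, hf⟩
        · exact ⟨Sum.inr b, .single (hc ▸ hs), by rintro _ ⟨⟩⟩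
      · exact ⟨Sum.inl n, .refl, by rintro _ ⟨⟩; omega⟩
  rcases u with n | b
  · exact key _ n le_rfl
  · exact ⟨Sum.inr b, .refl, by rintro _ ⟨⟩⟩

/-- Positions of labels increase along edges, so a path that has passed the first `τ` variables
never reads them again. The frontier part of the conclusion carries the induction. -/
theorem reflTransGen_step_congr (Z : OBDD X) (τ : ℕ) {a a' : X → Bool}
    (haa' : ∀ x, τ ≤ (Z.order x : ℕ) → a x = a' x) {u w : Z.Node ⊕ Bool}
    (hu : Z.IsFrontier τ u) (h : Relation.ReflTransGen (Z.Step a) u w) :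
    Relation.ReflTransGen (Z.Step a') u w ∧ Z.IsFrontier τ w := by
  induction h with
  | refl => exact ⟨.refl, hu⟩
  | tail _ hs ih =>
    obtain ⟨n, rfl, rfl⟩ := hs
    have hn := ih.2 n rfl
    refine ⟨ih.1.tail ⟨n, rfl, by rw [haa' _ hn]⟩, fun n' hn' => ?_⟩
    have hlt : (Z.order (Z.label n) : ℕ) < Z.order (Z.label n') := Z.ordered n n' _ hn'
    omega

/-- The computation is deterministic and a leaf has no leaving edge, so every node reached lies on
the way to the final leaf. -/
theorem accepts_iff_of_reach (Z : OBDD X) {a : X → Bool} {v : Z.Node ⊕ Bool}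
    (h : Relation.ReflTransGen (Z.Step a) Z.root v) :
    Z.Accepts a ↔ Relation.ReflTransGen (Z.Step a) v (Sum.inr true) := by
  refine ⟨fun ha => ?_, h.trans⟩
  rcases Relation.ReflTransGen.total_of_right_unique (Z.step_rightUnique a) h ha with h' | h'
  · exact h'
  · rcases h'.cases_head with h'' | ⟨_, ⟨n, hn, _⟩, _⟩
    · rw [← h'']
    · cases hn

/-- The assignment that follows `a` on the first `τ` variables and `b` on the others. -/
def mix (Z : OBDD X) (τ : ℕ) (a b : X → Bool) : X → Bool :=
  fun x => if (Z.order x : ℕ) < τ then a x else b x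

theorem reach_mix (Z : OBDD X) (τ : ℕ) {a : X → Bool} (b : X → Bool) {u v : Z.Node ⊕ Bool}
    (h : Relation.ReflTransGen (Z.StepBelow τ a) u v) :
    Relation.ReflTransGen (Z.Step (Z.mix τ a b)) u v := by
  refine Relation.ReflTransGen.mono ?_ _ _ h
  rintro _ _ ⟨n, rfl, hn, rfl⟩
  exact ⟨n, rfl, by simp [mix, hn]⟩

/-- A fooling set for a prefix of the variable order bounds the size of an OBDD from below. -/
theorem card_le_size_of_fooling (Z : OBDD X) (τ : ℕ) {ι : Type} [Fintype ι] (a b : ι → X → Bool)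
    (hdiag : ∀ i, Z.Accepts (Z.mix τ (a i) (b i)))
    (hoff : ∀ i j, Z.Accepts (Z.mix τ (a i) (b j)) → Z.Accepts (Z.mix τ (a j) (b i)) → i = j) :
    Fintype.card ι ≤ Z.size := by
  choose q hq hf using fun i => Z.exists_frontier τ (a i) Z.root
  -- Prefixes that arrive at the same frontier node are interchangeable for every suffix.
  have htransfer : ∀ i j, q i = q j → Z.Accepts (Z.mix τ (a j) (b i)) := by
    intro i j hij
    have h := hdiag i
    rw [Z.accepts_iff_of_reach (Z.reach_mix τ (b i) (hq i))] at h
    rw [Z.accepts_iff_of_reach (Z.reach_mix τ (b i) (hq j)), ← hij]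
    refine (Z.reflTransGen_step_congr τ (fun x hx => ?_) (hf i) h).1
    simp [mix, not_lt.mpr hx]
  have hinj : Function.Injective q := fun i j hij =>
    hoff i j (htransfer j i hij.symm) (htransfer i j hij)
  have := Z.finiteNode
  have hle := Nat.card_le_card_of_injective q hinj
  rw [Nat.card_eq_fintype_card, Nat.card_sum] at hle
  simpa [size] using hle

/-- A variable on which the computed function depends labels some node. -/
theorem exists_label_eq (Z : OBDD X) (x : X) {a a' : X → Bool} (haa' : ∀ y, y ≠ x → a y = a' y)
    (ha : Z.Accepts a) (ha' : ¬ Z.Accepts a') : ∃ n, Z.label n = x := by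
  by_contra! hne
  refine ha' (Relation.ReflTransGen.mono ?_ _ _ ha)
  rintro _ _ ⟨n, rfl, rfl⟩
  exact ⟨n, rfl, by rw [haa' _ (hne n)]⟩

end OBDD

/-! ### Guarded edge formulas -/

/-- All edges of `M` lead from `A` to its complement, and no two of them share an endpoint. -/
structure IsCrossMatching {U : Type} (A : U → Prop) (M : Finset (U × U)) : Prop where
  left : ∀ e ∈ M, A e.1
  right : ∀ e ∈ M, ¬ A e.2
  fst_inj : ∀ e ∈ M, ∀ e' ∈ M, e.1 = e'.1 → e = e'
  snd_inj : ∀ e ∈ M, ∀ e' ∈ M, e.2 = e'.2 → e = e'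

section GuardedCNF

variable {U : Type} [Encodable U]

/-- The name of the variable of the vertex `u`. -/
def vertexVar (u : U) : ℕ := Encodable.encode (Sum.inl u : U ⊕ U × U)

/-- The name of the guard variable of the ordered edge `e`. -/
def guardVar (e : U × U) : ℕ := Encodable.encode (Sum.inr e : U ⊕ U × U)

theorem vertexVar_injective : Function.Injective (vertexVar (U := U)) :=
  Encodable.encode_injective.comp Sum.inl_injective

theorem guardVar_injective : Function.Injective (guardVar (U := U)) :=
  Encodable.encode_injective.comp Sum.inr_injective

theorem vertexVar_ne_guardVar (u : U) (e : U × U) : vertexVar u ≠ guardVar e := fun h => by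
  simpa using Encodable.encode_injective h

/-- The clause `u ∨ v ∨ z` of the edge `e = (u, v)` with guard `z`. -/
def guardedClause (e : U × U) : Finset (ℕ × Bool) :=
  {(vertexVar e.1, true), (vertexVar e.2, true), (guardVar e, true)}

/-- The CNF with a guarded clause for every ordered pair in `E`. -/
def guardedCNF (E : Finset (U × U)) : CNF ℕ where
  clauses := E.image guardedClause
  consistent := by
    intro C hC x hx
    obtain ⟨e, -, rfl⟩ := Finset.mem_image.mp hC
    simp [guardedClause] at hx

variable {E : Finset (U × U)}

theorem mem_vars_guardedCNF {x : ℕ} : x ∈ (guardedCNF E).vars ↔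
    ∃ e ∈ E, x = vertexVar e.1 ∨ x = vertexVar e.2 ∨ x = guardVar e := by
  simp only [CNF.vars, guardedCNF, Finset.mem_biUnion, Finset.mem_image]
  constructor
  · rintro ⟨_, ⟨e, he, rfl⟩, ⟨y, b⟩, hy, rfl⟩
    refine ⟨e, he, ?_⟩
    simp only [guardedClause, Finset.mem_insert, Finset.mem_singleton, Prod.mk.injEq] at hy
    tauto
  · rintro ⟨e, he, h⟩
    refine ⟨_, ⟨e, he, rfl⟩, (x, true), ?_, rfl⟩
    simpa [guardedClause] using h

theorem guardVar_mem_vars {e : U × U} (he : e ∈ E) : guardVar e ∈ (guardedCNF E).vars :=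
  mem_vars_guardedCNF.mpr ⟨e, he, .inr (.inr rfl)⟩

theorem vertexVar_fst_mem_vars {e : U × U} (he : e ∈ E) : vertexVar e.1 ∈ (guardedCNF E).vars :=
  mem_vars_guardedCNF.mpr ⟨e, he, .inl rfl⟩

theorem vertexVar_snd_mem_vars {e : U × U} (he : e ∈ E) : vertexVar e.2 ∈ (guardedCNF E).vars :=
  mem_vars_guardedCNF.mpr ⟨e, he, .inr (.inl rfl)⟩

theorem card_le_numVars_guardedCNF (E : Finset (U × U)) : E.card ≤ (guardedCNF E).numVars := by
  rw [← Finset.card_image_of_injective E guardVar_injective]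
  refine Finset.card_le_card fun x hx => ?_
  obtain ⟨e, he, rfl⟩ := Finset.mem_image.mp hx
  exact guardVar_mem_vars he

theorem numVars_guardedCNF_le (E : Finset (U × U)) : (guardedCNF E).numVars ≤ 3 * E.card := by
  have hsub : (guardedCNF E).vars ⊆
      E.biUnion fun e => {vertexVar e.1, vertexVar e.2, guardVar e} := by
    intro x hx
    obtain ⟨e, he, h⟩ := mem_vars_guardedCNF.mp hx
    simp only [Finset.mem_biUnion, Finset.mem_insert, Finset.mem_singleton]
    exact ⟨e, he, h⟩
  refine (Finset.card_le_card hsub).trans ?_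
  rw [mul_comm]
  exact Finset.card_biUnion_le_card_mul _ _ _ fun _ _ => Finset.card_le_three

theorem sat_guardedCNF_iff (a : (guardedCNF E).vars → Bool) : (guardedCNF E).Sat a ↔
    ∀ (e : U × U) (he : e ∈ E), a ⟨_, vertexVar_fst_mem_vars he⟩ = true ∨
      a ⟨_, vertexVar_snd_mem_vars he⟩ = true ∨ a ⟨_, guardVar_mem_vars he⟩ = true := by
  simp only [CNF.Sat]
  constructor
  · intro h e he
    obtain ⟨⟨x, hx⟩, hxe⟩ := h (guardedClause e) (Finset.mem_image_of_mem _ he)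
    simp only [guardedClause, Finset.mem_insert, Finset.mem_singleton, Prod.mk.injEq] at hxe
    rcases hxe with ⟨rfl, h⟩ | ⟨rfl, h⟩ | ⟨rfl, h⟩
    exacts [.inl h, .inr (.inl h), .inr (.inr h)]
  · intro h C hC
    obtain ⟨e, he, rfl⟩ := Finset.mem_image.mp hC
    rcases h e he with h | h | h
    · exact ⟨_, by rw [h]; simp [guardedClause]⟩
    · exact ⟨_, by rw [h]; simp [guardedClause]⟩
    · exact ⟨_, by rw [h]; simp [guardedClause]⟩

/-- The assignment given by `f` on the vertices and `g` on the guards. -/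
def vertexGuardAssignment (f : U → Bool) (g : U × U → Bool) (n : ℕ) : Bool :=
  (Encodable.decode (α := U ⊕ U × U) n).elim false (Sum.elim f g)

@[simp] theorem vertexGuardAssignment_vertexVar (f : U → Bool) (g : U × U → Bool) (u : U) :
    vertexGuardAssignment f g (vertexVar u) = f u := by
  rw [vertexGuardAssignment, vertexVar, Encodable.encodek]; rfl

@[simp] theorem vertexGuardAssignment_guardVar (f : U → Bool) (g : U × U → Bool) (e : U × U) :
    vertexGuardAssignment f g (guardVar e) = g e := by
  rw [vertexGuardAssignment, guardVar, Encodable.encodek]; rfl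

/-- The endpoints of a matching across a prefix of the variable order can be set independently. -/
theorem two_pow_le_size_of_isCrossMatching (Z : OBDD (guardedCNF E).vars)
    (hZ : (guardedCNF E).ComputedBy Z) (τ : ℕ) {A : U → Prop}
    (hA : ∀ u (hu : vertexVar u ∈ (guardedCNF E).vars), A u ↔ (Z.order ⟨_, hu⟩ : ℕ) < τ)
    {M : Finset (U × U)} (hM : IsCrossMatching A M) (hME : M ⊆ E) : 2 ^ M.card ≤ Z.size := by
  classical
  -- Only the clauses of `M` remain to be satisfied by vertices. Both halves use the same guard
  -- values, so the positions of the guards in the order do not matter.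
  let g : U × U → Bool := fun e => decide (e ∉ M)
  -- The early half makes the left endpoints of `S` true; the late half makes the right endpoints of
  -- `T` false. The edges of `T` then rely on `S`, so acceptance means `T ⊆ S`.
  let a : M.powerset → (guardedCNF E).vars → Bool := fun S x =>
    vertexGuardAssignment (fun u => decide (∃ e ∈ S.1, e.1 = u)) g x
  let b : M.powerset → (guardedCNF E).vars → Bool := fun S x =>
    vertexGuardAssignment (fun u => decide (∀ e ∈ S.1, e.2 ≠ u)) g x
  have hacc : ∀ S T : M.powerset, Z.Accepts (Z.mix τ (a S) (b T)) ↔ T.1 ⊆ S.1 := by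
    intro S T
    have hS := Finset.mem_powerset.mp S.2
    have hT := Finset.mem_powerset.mp T.2
    have hguard : ∀ e (he : e ∈ E), Z.mix τ (a S) (b T) ⟨_, guardVar_mem_vars he⟩ = g e := by
      intro e he
      simp [OBDD.mix, a, b]
    have hfst : ∀ e (he : e ∈ E), e ∈ M →
        (Z.mix τ (a S) (b T) ⟨_, vertexVar_fst_mem_vars he⟩ = true ↔ e ∈ S.1) := by
      intro e he heM
      have h1 := (hA _ (vertexVar_fst_mem_vars he)).mp (hM.left e heM)
      simp only [OBDD.mix, h1, if_true, a, vertexGuardAssignment_vertexVar, decide_eq_true_eq]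
      refine ⟨?_, fun h => ⟨e, h, rfl⟩⟩
      rintro ⟨e', he', h⟩
      rwa [← hM.fst_inj e' (hS he') e heM h]
    have hsnd : ∀ e (he : e ∈ E), e ∈ M →
        (Z.mix τ (a S) (b T) ⟨_, vertexVar_snd_mem_vars he⟩ = true ↔ e ∉ T.1) := by
      intro e he heM
      have h1 := (hA _ (vertexVar_snd_mem_vars he)).not.mp (hM.right e heM)
      simp only [OBDD.mix, h1, if_false, b, vertexGuardAssignment_vertexVar, decide_eq_true_eq]
      refine ⟨fun h h' => h e h' rfl, ?_⟩
      intro h e' he' h'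
      exact h (hM.snd_inj e' (hT he') e heM h' ▸ he')
    rw [hZ, sat_guardedCNF_iff]
    constructor
    · intro h e heT
      have heM := hT heT
      have he := hME heM
      rcases h e he with h | h | h
      · exact (hfst e he heM).mp h
      · exact absurd heT ((hsnd e he heM).mp h)
      · rw [hguard e he] at h
        simp [g, heM] at h
    · intro h e he
      by_cases heM : e ∈ M
      · rw [hfst e he heM, hsnd e he heM]
        by_cases heT : e ∈ T.1
        · exact .inl (h heT)
        · exact .inr (.inl heT)
      · rw [hguard e he]
        simp [g, heM]
  have hle := Z.card_le_size_of_fooling τ a b (fun S => (hacc S S).mpr (Finset.Subset.refl _))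
    (fun S T h1 h2 => Subtype.ext
      (Finset.Subset.antisymm ((hacc T S).mp h2) ((hacc S T).mp h1)))
  simpa using hle

/-- If every linear order of the endpoints of `E` has a prefix across which `E` contains a matching
of size `s`, then the OBDD size of the guarded CNF is at least `2 ^ s`. -/
theorem two_pow_le_obddSize_guardedCNF (s : ℕ)
    (h : ∀ ord : U → ℕ, Set.InjOn ord {u | ∃ e ∈ E, u = e.1 ∨ u = e.2} →
      ∃ (τ : ℕ) (M : Finset (U × U)), M ⊆ E ∧ IsCrossMatching (fun u => ord u < τ) M ∧
        s ≤ M.card) : 2 ^ s ≤ (guardedCNF E).obddSize := by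
  classical
  have hne : {s | ∃ Z : OBDD (guardedCNF E).vars, (guardedCNF E).ComputedBy Z ∧
      Z.size = s}.Nonempty :=
    let ⟨Z, hZ⟩ := (guardedCNF E).exists_computedBy
    ⟨_, Z, hZ, rfl⟩
  obtain ⟨Z, hZ, hsize⟩ := Nat.sInf_mem hne
  change 2 ^ s ≤ sInf _
  rw [← hsize]
  -- The value `0` is a dummy: injectivity is required only on endpoints of `E`, whose variables all
  -- occur.
  let ord : U → ℕ := fun u =>
    if hu : vertexVar u ∈ (guardedCNF E).vars then (Z.order ⟨_, hu⟩ : ℕ) else 0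
  have hmem : ∀ u, (∃ e ∈ E, u = e.1 ∨ u = e.2) → vertexVar u ∈ (guardedCNF E).vars := by
    rintro u ⟨e, he, rfl | rfl⟩
    exacts [vertexVar_fst_mem_vars he, vertexVar_snd_mem_vars he]
  obtain ⟨τ, M, hME, hM, hs⟩ := h ord (by
    intro u hu v hv huv
    simp only [ord, dif_pos (hmem u hu), dif_pos (hmem v hv)] at huv
    have := Z.order.injective (Fin.ext huv)
    exact vertexVar_injective (congrArg Subtype.val this))
  refine (Nat.pow_le_pow_right two_pos hs).trans
    (two_pow_le_size_of_isCrossMatching Z hZ τ (fun u hu => ?_) hM hME)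
  simp only [ord, dif_pos hu]

end GuardedCNF

/-! ### The blown-up ternary tree -/

/-- The nodes of the complete ternary tree of depth `n`; the parent of `s` is `s.tail`. -/
def ternaryNodes : ℕ → Finset (List (Fin 3))
  | 0 => {[]}
  | n + 1 => insert [] ((Finset.univ ×ˢ ternaryNodes n).image fun x => x.1 :: x.2)

@[simp] theorem mem_ternaryNodes {n : ℕ} {s : List (Fin 3)} :
    s ∈ ternaryNodes n ↔ s.length ≤ n := by
  induction n generalizing s with
  | zero => simp [ternaryNodes]
  | succ n ih => cases s <;> simp [ternaryNodes, ih]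

theorem card_ternaryNodes_succ (n : ℕ) :
    (ternaryNodes (n + 1)).card = 3 * (ternaryNodes n).card + 1 := by
  rw [ternaryNodes, Finset.card_insert_of_notMem (by simp), Finset.card_image_of_injective]
  · simp [Finset.card_product]
  · rintro ⟨a, s⟩ ⟨b, t⟩ h
    simpa using h

theorem pow_le_card_ternaryNodes (n : ℕ) : 3 ^ n ≤ (ternaryNodes n).card := by
  induction n with
  | zero => simp [ternaryNodes]
  | succ n ih => rw [card_ternaryNodes_succ, pow_succ]; omega

theorem card_ternaryNodes_lt (n : ℕ) : (ternaryNodes n).card < 2 * 3 ^ n := by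
  induction n with
  | zero => simp [ternaryNodes]
  | succ n ih => rw [card_ternaryNodes_succ, pow_succ]; omega

/-- The vertices over a node and its parent. -/
def treeBag (k : ℕ) (s : List (Fin 3)) : Finset (List (Fin 3) × Fin k) :=
  {s, s.tail} ×ˢ Finset.univ

@[simp] theorem mem_treeBag {k : ℕ} {s : List (Fin 3)} {u : List (Fin 3) × Fin k} :
    u ∈ treeBag k s ↔ u.1 = s ∨ u.1 = s.tail := by
  simp [treeBag]

theorem card_treeBag_le (k : ℕ) (s : List (Fin 3)) : (treeBag k s).card ≤ 2 * k := by
  rw [treeBag, Finset.card_product, Finset.card_univ, Fintype.card_fin]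
  exact Nat.mul_le_mul_right k Finset.card_le_two

/-- The ordered pairs of vertices that lie in a common bag. -/
def treeEdges (k n : ℕ) : Finset ((List (Fin 3) × Fin k) × (List (Fin 3) × Fin k)) :=
  (ternaryNodes n).biUnion fun s => treeBag k s ×ˢ treeBag k s

theorem mem_treeEdges {k n : ℕ} {e : (List (Fin 3) × Fin k) × (List (Fin 3) × Fin k)} :
    e ∈ treeEdges k n ↔ ∃ s, s.length ≤ n ∧ e.1 ∈ treeBag k s ∧ e.2 ∈ treeBag k s := by
  simp only [treeEdges, Finset.mem_biUnion, mem_ternaryNodes, Finset.mem_product]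

theorem length_fst_le_of_mem_treeEdges {k n : ℕ}
    {e : (List (Fin 3) × Fin k) × (List (Fin 3) × Fin k)} (he : e ∈ treeEdges k n) :
    e.1.1.length ≤ n := by
  obtain ⟨s, hs, h, -⟩ := mem_treeEdges.mp he
  rcases mem_treeBag.mp h with h | h <;> rw [h]
  · exact hs
  · rw [List.length_tail]; omega

theorem length_snd_le_of_mem_treeEdges {k n : ℕ}
    {e : (List (Fin 3) × Fin k) × (List (Fin 3) × Fin k)} (he : e ∈ treeEdges k n) :
    e.2.1.length ≤ n := by
  obtain ⟨s, hs, -, h⟩ := mem_treeEdges.mp he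
  exact length_fst_le_of_mem_treeEdges (e := (e.2, e.2)) (mem_treeEdges.mpr ⟨s, hs, h, h⟩)

theorem card_treeEdges_le (k n : ℕ) : (treeEdges k n).card ≤ 2 * 3 ^ n * (2 * k * (2 * k)) := by
  refine (Finset.card_biUnion_le_card_mul _ _ (2 * k * (2 * k)) fun s _ => ?_).trans
    (Nat.mul_le_mul_right _ (card_ternaryNodes_lt n).le)
  rw [Finset.card_product]
  exact Nat.mul_le_mul (card_treeBag_le k s) (card_treeBag_le k s)

theorem pow_le_card_treeEdges {k : ℕ} (hk : 0 < k) (n : ℕ) : 3 ^ n ≤ (treeEdges k n).card := by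
  refine (pow_le_card_ternaryNodes n).trans ?_
  refine Finset.card_le_card_of_injOn (fun s => ((s, ⟨0, hk⟩), (s, ⟨0, hk⟩))) ?_ ?_
  · intro s hs
    simp only [Finset.mem_coe, mem_ternaryNodes] at hs
    exact mem_treeEdges.mpr ⟨s, hs, by simp, by simp⟩
  · intro s _ t _ h
    simpa using h

/-! ### Matchings across prefixes of a linear order of the blown-up tree -/

/-- Along a path down the tree, a change of `P` happens at an edge. -/
theorem exists_switch {α : Type} (P : List α → Prop) (t w : List α) (ht : P t)
    (hw : ¬ P (w ++ t)) : ∃ c w', c :: w' <:+ w ∧ P (w' ++ t) ∧ ¬ P (c :: w' ++ t) := by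
  induction w with
  | nil => exact absurd ht hw
  | cons c w ih =>
    by_cases h : P (w ++ t)
    · exact ⟨c, w, List.suffix_rfl, h, hw⟩
    · obtain ⟨c', w', hs, h1, h2⟩ := ih h
      exact ⟨c', w', hs.trans (List.suffix_cons c w), h1, h2⟩

/-- Suffixes of `b` of equal length coincide, so `b` and its ancestors cannot lie below two
different children of `t`. -/
theorem not_cons_suffix_of_suffix {α : Type} {j l : α} {t x b : List α} (hlj : l ≠ j)
    (hlb : l :: t <:+ b) (hxb : x <:+ b) : ¬ j :: t <:+ x := by
  intro hjx
  obtain ⟨u, hu⟩ := hjx.trans hxb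
  obtain ⟨v, hv⟩ := hlb
  have := (List.append_inj' (hv.trans hu.symm) (by simp)).2
  exact hlj (List.cons.inj this).1

/-- If `A` holds somewhere below the child `i` of `t` and fails somewhere below the child `l`, then it
changes along a tree edge below `t` that is not below the child `j`. -/
theorem exists_treeEdge_switch {A : List (Fin 3) → Prop} {n : ℕ} {t a b : List (Fin 3)}
    {i j l : Fin 3} (hij : i ≠ j) (hlj : l ≠ j) (hia : i :: t <:+ a) (hlb : l :: t <:+ b)
    (hna : a.length ≤ n) (hnb : b.length ≤ n) (ha : A a) (hb : ¬ A b) :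
    ∃ x y, A x ∧ ¬ A y ∧ (∃ s, s.length ≤ n ∧ (x = s ∨ x = s.tail) ∧ (y = s ∨ y = s.tail)) ∧
      (t <:+ x ∧ t <:+ y) ∧ ¬ j :: t <:+ x ∧ ¬ j :: t <:+ y := by
  have hdown : ∀ (P : List (Fin 3) → Prop) (m : Fin 3) (d : List (Fin 3)), m ≠ j → m :: t <:+ d →
      d.length ≤ n → P t → ¬ P d → ∃ x s, P x ∧ ¬ P s ∧ s.length ≤ n ∧ x = s.tail ∧
        (t <:+ x ∧ t <:+ s) ∧ ¬ j :: t <:+ x ∧ ¬ j :: t <:+ s := by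
    intro P m d hmj hmd hd hPt hPd
    obtain ⟨w, rfl⟩ := (List.suffix_cons m t).trans hmd
    obtain ⟨c, w', ⟨v, hv⟩, h1, h2⟩ := exists_switch P t w hPt hPd
    have hs : c :: w' ++ t <:+ w ++ t := ⟨v, by rw [← hv]; simp⟩
    have hx : w' ++ t <:+ w ++ t := (List.suffix_cons c _).trans hs
    exact ⟨w' ++ t, c :: w' ++ t, h1, h2, hs.length_le.trans hd, rfl,
      ⟨List.suffix_append _ _, List.suffix_append _ _⟩,
      not_cons_suffix_of_suffix hmj hmd hx, not_cons_suffix_of_suffix hmj hmd hs⟩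
  -- The path from `a` to `b` through `t` changes sides on its lower half towards `b` if `A t`
  -- holds, and on the half towards `a` otherwise.
  by_cases ht : A t
  · obtain ⟨x, s, h1, h2, h3, h4, h5, h6, h7⟩ := hdown A l b hlj hlb hnb ht hb
    exact ⟨x, s, h1, h2, ⟨s, h3, .inr h4, .inl rfl⟩, h5, h6, h7⟩
  · obtain ⟨x, s, h1, h2, h3, h4, h5, h6, h7⟩ :=
      hdown (fun z => ¬ A z) i a hij hia hna ht (not_not.mpr ha)
    exact ⟨s, x, not_not.mp h2, h1, ⟨s, h3, .inl rfl, .inr h4⟩, h5.symm, h7, h6⟩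

/-- At some time, there is a matching of size `s` across the cut below the node `t`, and below `t` there
are a column entirely before the cut and a column entirely after it. -/
def HasBalancedCut {k : ℕ} (n : ℕ) (ord : List (Fin 3) × Fin k → ℕ) (t : List (Fin 3)) (s : ℕ) :
    Prop :=
  ∃ (τ : ℕ) (M : Finset ((List (Fin 3) × Fin k) × (List (Fin 3) × Fin k))),
    (M ⊆ treeEdges k n ∧ IsCrossMatching (fun u => ord u < τ) M ∧ s ≤ M.card ∧
      ∀ e ∈ M, t <:+ e.1.1 ∧ t <:+ e.2.1) ∧
    (∃ a, t <:+ a ∧ a.length ≤ n ∧ ∀ r, ord (a, r) < τ) ∧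
    (∃ b, t <:+ b ∧ b.length ≤ n ∧ ∀ r, τ ≤ ord (b, r))

theorem exists_median (τ : Fin 3 → ℕ) : ∃ i j l, i ≠ j ∧ l ≠ j ∧ τ i ≤ τ j ∧ τ j ≤ τ l := by
  rcases le_total (τ 0) (τ 1) with h01 | h01 <;> rcases le_total (τ 1) (τ 2) with h12 | h12 <;>
    rcases le_total (τ 0) (τ 2) with h02 | h02
  · exact ⟨0, 1, 2, by decide, by decide, h01, h12⟩
  · exact ⟨0, 1, 2, by decide, by decide, h01, h12⟩
  · exact ⟨0, 2, 1, by decide, by decide, h02, h12⟩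
  · exact ⟨2, 0, 1, by decide, by decide, h02, h01⟩
  · exact ⟨1, 0, 2, by decide, by decide, h01, h02⟩
  · exact ⟨1, 2, 0, by decide, by decide, h12, h02⟩
  · exact ⟨2, 1, 0, by decide, by decide, h12, h01⟩
  · exact ⟨2, 1, 0, by decide, by decide, h12, h01⟩

/-- Cut at the median time `τ j`. The full column below `i` is already complete and the empty column
below `l` is still untouched. In each of the `k` copies of the tree, the path joining these columns
through `t` must cross the cut, and it avoids the subtree of `j`. These `k` edges therefore extend
the matching found there, and the same two columns witness balance at `t`. -/
theorem hasBalancedCut_of_children {k n : ℕ} {ord : List (Fin 3) × Fin k → ℕ} {t : List (Fin 3)}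
    {s : ℕ} (h : ∀ i, HasBalancedCut n ord (i :: t) s) : HasBalancedCut n ord t (s + k) := by
  classical
  choose τ M hM hpre hpost using h
  obtain ⟨i, j, l, hij, hlj, hτi, hτl⟩ := exists_median τ
  obtain ⟨a, hia, hna, ha⟩ := hpre i
  obtain ⟨b, hlb, hnb, hb⟩ := hpost l
  obtain ⟨hME, hMc, hMs, hMt⟩ := hM j
  choose x y hx hy hxy hxyt hxj hyj using fun r : Fin k =>
    exists_treeEdge_switch (A := fun z => ord (z, r) < τ j) hij hlj hia hlb hna hnb
      ((ha r).trans_le hτi) (not_lt.mpr (hτl.trans (hb r)))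
  let N : Finset ((List (Fin 3) × Fin k) × (List (Fin 3) × Fin k)) :=
    Finset.univ.image fun r => ((x r, r), (y r, r))
  have hN : ∀ e ∈ N, ∃ r, e = ((x r, r), (y r, r)) := by
    intro e he
    obtain ⟨r, -, rfl⟩ := Finset.mem_image.mp he
    exact ⟨r, rfl⟩
  have hNcard : N.card = k := by
    rw [Finset.card_image_of_injective, Finset.card_univ, Fintype.card_fin]
    intro r r' hr
    exact (Prod.mk.inj (Prod.mk.inj hr).1).2
  have hdisj : Disjoint (M j) N := by
    refine Finset.disjoint_left.mpr fun e he he' => ?_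
    obtain ⟨r, rfl⟩ := hN e he'
    exact hxj r (hMt _ he).1
  refine ⟨τ j, M j ∪ N, ⟨?_, ⟨?_, ?_, ?_, ?_⟩, ?_, ?_⟩, ?_, ?_⟩
  · refine Finset.union_subset hME fun e he => ?_
    obtain ⟨r, rfl⟩ := hN e he
    obtain ⟨s, hs, h1, h2⟩ := hxy r
    exact mem_treeEdges.mpr ⟨s, hs, mem_treeBag.mpr h1, mem_treeBag.mpr h2⟩
  · intro e he
    rcases Finset.mem_union.mp he with he | he
    · exact hMc.left e he
    · obtain ⟨r, rfl⟩ := hN e he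
      exact hx r
  · intro e he
    rcases Finset.mem_union.mp he with he | he
    · exact hMc.right e he
    · obtain ⟨r, rfl⟩ := hN e he
      exact hy r
  · intro e he e' he' hee'
    rcases Finset.mem_union.mp he with he | he <;> rcases Finset.mem_union.mp he' with he' | he'
    · exact hMc.fst_inj e he e' he' hee'
    · obtain ⟨r, rfl⟩ := hN e' he'
      exact (hxj r (by have h := (hMt e he).1; rwa [hee'] at h)).elim
    · obtain ⟨r, rfl⟩ := hN e he
      exact (hxj r (by have h := (hMt e' he').1; rwa [← hee'] at h)).elim
    · obtain ⟨r, rfl⟩ := hN e he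
      obtain ⟨r', rfl⟩ := hN e' he'
      obtain rfl : r = r' := congrArg Prod.snd hee'
      rfl
  · intro e he e' he' hee'
    rcases Finset.mem_union.mp he with he | he <;> rcases Finset.mem_union.mp he' with he' | he'
    · exact hMc.snd_inj e he e' he' hee'
    · obtain ⟨r, rfl⟩ := hN e' he'
      exact (hyj r (by have h := (hMt e he).2; rwa [hee'] at h)).elim
    · obtain ⟨r, rfl⟩ := hN e he
      exact (hyj r (by have h := (hMt e' he').2; rwa [← hee'] at h)).elim
    · obtain ⟨r, rfl⟩ := hN e he
      obtain ⟨r', rfl⟩ := hN e' he'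
      obtain rfl : r = r' := congrArg Prod.snd hee'
      rfl
  · rw [Finset.card_union_of_disjoint hdisj, hNcard]
    exact Nat.add_le_add_right hMs k
  · intro e he
    rcases Finset.mem_union.mp he with he | he
    · exact ⟨(List.suffix_cons j t).trans (hMt e he).1, (List.suffix_cons j t).trans (hMt e he).2⟩
    · obtain ⟨r, rfl⟩ := hN e he
      exact hxyt r
  · exact ⟨a, (List.suffix_cons i t).trans hia, hna, fun r => (ha r).trans_le hτi⟩
  · exact ⟨b, (List.suffix_cons l t).trans hlb, hnb, fun r => hτl.trans (hb r)⟩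

/-- At the first time when some column below `t` is complete, either another column is untouched, or
every other column is cut. -/
theorem hasBalancedCut_zero_or {k n D T : ℕ} (hk : 0 < k) {ord : List (Fin 3) × Fin k → ℕ}
    (hord : Set.InjOn ord {u | u.1.length ≤ n}) {t : List (Fin 3)} (ht : t.length + D ≤ n)
    (hD : T + 1 ≤ 3 ^ D) : HasBalancedCut n ord t 0 ∨
      ∃ (τ : ℕ) (M : Finset ((List (Fin 3) × Fin k) × (List (Fin 3) × Fin k))),
        M ⊆ treeEdges k n ∧ IsCrossMatching (fun u => ord u < τ) M ∧ T ≤ M.card := by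
  classical
  let C : Finset (List (Fin 3)) := (ternaryNodes D).image (· ++ t)
  have hCcard : T + 1 ≤ C.card := by
    rw [Finset.card_image_of_injective _ (List.append_left_injective t)]
    exact hD.trans (pow_le_card_ternaryNodes D)
  have hC : ∀ c ∈ C, t <:+ c ∧ c.length ≤ n := by
    intro c hc
    obtain ⟨w, hw, rfl⟩ := Finset.mem_image.mp hc
    rw [mem_ternaryNodes] at hw
    exact ⟨List.suffix_append _ _, by rw [List.length_append]; omega⟩
  have hex : ∃ τ, ∃ c ∈ C, ∀ r, ord (c, r) < τ := by
    obtain ⟨c, hc⟩ := Finset.card_pos.mp (show 0 < C.card by omega)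
    exact ⟨Finset.univ.sup (fun r => ord (c, r)) + 1, c, hc, fun r =>
      Nat.lt_succ_of_le (Finset.le_sup (f := fun r => ord (c, r)) (Finset.mem_univ r))⟩
  obtain ⟨c, hc, hcτ⟩ := Nat.find_spec hex
  have hmin : ∀ {τ'}, τ' < Nat.find hex → ∀ c' ∈ C, ∃ r, τ' ≤ ord (c', r) := by
    intro τ' h' c' hc'
    by_contra! hcon
    exact Nat.find_min hex h' ⟨c', hc', hcon⟩
  generalize Nat.find hex = τ at hcτ hmin
  -- Two columns completed at the same first time would both contain a vertex at position `τ - 1`,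
  -- against injectivity.
  have hother : ∀ c' ∈ C.erase c, ∃ r, τ ≤ ord (c', r) := by
    intro c' hc'
    obtain ⟨hne, hc'⟩ := Finset.mem_erase.mp hc'
    by_contra! hcon
    -- This gives `0 < τ`, so that `τ - 1` is really an earlier time.
    have h0 := hcτ ⟨0, hk⟩
    obtain ⟨r, hr⟩ := hmin (τ' := τ - 1) (by omega) c hc
    obtain ⟨r', hr'⟩ := hmin (τ' := τ - 1) (by omega) c' hc'
    have h1 := hcτ r
    have h2 := hcon r'
    have := hord (show (c', r') ∈ _ from (hC c' hc').2)
      (show (c, r) ∈ _ from (hC c hc).2) (by omega)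
    exact hne (congrArg Prod.fst this)
  by_cases hb : ∃ b ∈ C, ∀ r, τ ≤ ord (b, r)
  · obtain ⟨b, hbC, hb⟩ := hb
    exact .inl ⟨τ, ∅, ⟨by simp, ⟨by simp, by simp, by simp, by simp⟩, by simp, by simp⟩,
      ⟨c, (hC c hc).1, (hC c hc).2, hcτ⟩, ⟨b, (hC b hbC).1, (hC b hbC).2, hb⟩⟩
  · right
    push Not at hb
    -- Each remaining column has a vertex on either side of the cut; these are joined, and different
    -- columns give disjoint edges.
    have h : ∀ c' : List (Fin 3), ∃ q : Fin k × Fin k, c' ∈ C.erase c →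
        ord (c', q.1) < τ ∧ τ ≤ ord (c', q.2) := by
      intro c'
      by_cases hc' : c' ∈ C.erase c
      · obtain ⟨r, hr⟩ := hb c' (Finset.mem_of_mem_erase hc')
        obtain ⟨r', hr'⟩ := hother c' hc'
        exact ⟨(r, r'), fun _ => ⟨hr, hr'⟩⟩
      · exact ⟨(⟨0, hk⟩, ⟨0, hk⟩), fun h => absurd h hc'⟩
    choose q hq using h
    refine ⟨τ, (C.erase c).image fun c' => ((c', (q c').1), (c', (q c').2)), ?_,
      ⟨?_, ?_, ?_, ?_⟩, ?_⟩
    · intro e he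
      obtain ⟨c', hc', rfl⟩ := Finset.mem_image.mp he
      exact mem_treeEdges.mpr ⟨c', (hC c' (Finset.mem_of_mem_erase hc')).2, by simp, by simp⟩
    · intro e he
      obtain ⟨c', hc', rfl⟩ := Finset.mem_image.mp he
      exact (hq c' hc').1
    · intro e he
      obtain ⟨c', hc', rfl⟩ := Finset.mem_image.mp he
      exact not_lt.mpr (hq c' hc').2
    · intro e he e' he' hee'
      obtain ⟨c', -, rfl⟩ := Finset.mem_image.mp he
      obtain ⟨c'', -, rfl⟩ := Finset.mem_image.mp he'
      obtain rfl : c' = c'' := congrArg Prod.fst hee'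
      rfl
    · intro e he e' he' hee'
      obtain ⟨c', -, rfl⟩ := Finset.mem_image.mp he
      obtain ⟨c'', -, rfl⟩ := Finset.mem_image.mp he'
      obtain rfl : c' = c'' := congrArg Prod.fst hee'
      rfl
    · rw [Finset.card_image_of_injective, Finset.card_erase_of_mem hc]
      · omega
      · intro c' c'' h
        exact congrArg (fun e => e.1.1) h

/-- Every linear order of the vertices has a prefix with a matching of size `k * H` across it. -/
theorem exists_isCrossMatching_treeEdges {k H D : ℕ} (hk : 0 < k) (hD : k * H + 1 ≤ 3 ^ D)
    {ord : List (Fin 3) × Fin k → ℕ} (hord : Set.InjOn ord {u | u.1.length ≤ H + D}) :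
    ∃ (τ : ℕ) (M : Finset ((List (Fin 3) × Fin k) × (List (Fin 3) × Fin k))),
      M ⊆ treeEdges k (H + D) ∧ IsCrossMatching (fun u => ord u < τ) M ∧ k * H ≤ M.card := by
  -- If no large matching exists, the second alternative of `hasBalancedCut_zero_or` is excluded, so
  -- every node at depth `H` starts the induction.
  by_contra hcon
  have key : ∀ h (t : List (Fin 3)), t.length + h = H →
      HasBalancedCut (H + D) ord t (k * h) := by
    intro h
    induction h with
    | zero =>
      intro t ht
      exact (hasBalancedCut_zero_or hk hord (by omega) hD).resolve_right hcon
    | succ h ih =>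
      intro t ht
      exact hasBalancedCut_of_children fun i => ih (i :: t) (by rw [List.length_cons]; omega)
  obtain ⟨τ, M, ⟨h1, h2, h3, -⟩, -⟩ := key H [] (by simp)
  exact hcon ⟨τ, M, h1, h2, h3⟩

/-! ### Rooted trees -/

/-- The graph that joins every element to its parent. -/
def parentGraph {I : Type} (parent : I → I) : SimpleGraph I where
  Adj x y := x ≠ y ∧ (parent x = y ∨ parent y = x)
  symm := ⟨fun _ _ h => ⟨h.1.symm, h.2.symm⟩⟩
  loopless := ⟨fun _ h => h.1 rfl⟩

section ParentGraph

variable {I : Type} {parent : I → I} {depth : I → ℕ}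

/-- A set that contains the parents of all its elements but the top one is connected. -/
theorem connected_induce_parentGraph (S : Set I) (top : I) (htop : top ∈ S)
    (hdepth : ∀ x ∈ S, x ≠ top → depth (parent x) < depth x)
    (hparent : ∀ x ∈ S, x ≠ top → parent x ∈ S) :
    ((parentGraph parent).induce S).Connected := by
  have key : ∀ d x (hx : x ∈ S), depth x ≤ d →
      ((parentGraph parent).induce S).Reachable ⟨x, hx⟩ ⟨top, htop⟩ := by
    intro d
    induction d with
    | zero =>
      intro x hx hd
      by_cases hxt : x = top
      · subst hxt; exact .refl _
      · have := hdepth x hx hxt; omega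
    | succ d ih =>
      intro x hx hd
      by_cases hxt : x = top
      · subst hxt; exact .refl _
      · have hlt := hdepth x hx hxt
        have hadj : ((parentGraph parent).induce S).Adj ⟨x, hx⟩ ⟨_, hparent x hx hxt⟩ :=
          ⟨fun h => hlt.ne (congrArg depth h).symm, .inl rfl⟩
        exact hadj.reachable.trans (ih _ _ (by omega))
  have : Nonempty S := ⟨⟨top, htop⟩⟩
  exact ⟨fun x y => (key _ x.1 x.2 le_rfl).trans (key _ y.1 y.2 le_rfl).symm⟩

/-- The graph is connected, and every edge joins a non-root element to its parent, so there are
fewer edges than vertices. -/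
theorem isTree_parentGraph [Finite I] (root : I)
    (hdepth : ∀ x, x ≠ root → depth (parent x) < depth x) (hroot : parent root = root) :
    (parentGraph parent).IsTree := by
  classical
  have := Fintype.ofFinite I
  have hconn : (parentGraph parent).Connected := by
    have h := connected_induce_parentGraph (parent := parent) (depth := depth) Set.univ root
      (Set.mem_univ _) (fun x _ => hdepth x) (fun _ _ _ => Set.mem_univ _)
    exact (SimpleGraph.induceUnivIso _).connected_iff.mp h
  refine SimpleGraph.isTree_iff_connected_and_card.mpr ⟨hconn, le_antisymm ?_
    hconn.card_vert_le_card_edgeSet_add_one⟩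
  have hsub : (parentGraph parent).edgeSet ⊆
      ((Finset.univ.erase root).image fun x => s(x, parent x) : Finset (Sym2 I)) := by
    intro e
    induction e with
    | _ x y =>
      intro h
      rw [SimpleGraph.mem_edgeSet] at h
      obtain ⟨hne, h | h⟩ := h
      · simp only [Finset.coe_image, Set.mem_image, Finset.mem_coe, Finset.mem_erase,
          Finset.mem_univ, and_true]
        exact ⟨x, by rintro rfl; exact hne (hroot ▸ h), by rw [h]⟩
      · simp only [Finset.coe_image, Set.mem_image, Finset.mem_coe, Finset.mem_erase,
          Finset.mem_univ, and_true]
        exact ⟨y, by rintro rfl; exact hne (hroot ▸ h).symm, by rw [h, Sym2.eq_swap]⟩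
  have hcard := Set.ncard_le_ncard hsub (Finset.finite_toSet _)
  rw [Set.ncard_coe_finset] at hcard
  have h1 := Finset.card_image_le (s := Finset.univ.erase root) (f := fun x => s(x, parent x))
  rw [Finset.card_erase_of_mem (Finset.mem_univ _), Finset.card_univ] at h1
  have hpos : 0 < Fintype.card I := Fintype.card_pos_iff.mpr ⟨root⟩
  rw [Nat.card_eq_fintype_card (α := I)]
  change Nat.card (parentGraph parent).edgeSet ≤ _ at hcard
  omega

end ParentGraph

/-! ### Treewidth of the guarded CNF of the blown-up tree -/

theorem treewidth_le_of_card_bag_le {W : Type} {G : SimpleGraph W} (D : TreeDecomposition G) {p : ℕ}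
    (h : ∀ t, (D.bag t).card ≤ p + 1) : treewidth G ≤ p := by
  have hle : treewidth G ≤ D.width := Nat.sInf_le ⟨D, rfl⟩
  refine hle.trans ?_
  have := @Finset.sup_le _ _ _ _ (@Finset.univ D.Idx D.fintypeIdx)
    (fun t => (D.bag t).card) (p + 1) fun t _ => h t
  rw [TreeDecomposition.width]
  omega

theorem card_finsetSubtype_le {α : Type} (P : α → Prop) [DecidablePred P] (s : Finset α) :
    (s.subtype P).card ≤ s.card := by
  rw [Finset.card_subtype]
  exact Finset.card_filter_le _ _

/-- The ternary tree itself, with two adjacent columns per bag, covers the vertex pairs. Each clause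
then gets a leaf, with its at most three variables as bag, hung below a node whose bag contains both
endpoints. -/
theorem treewidth_guardedCNF_treeEdges_le {k n p : ℕ} (hkp : 2 * k ≤ p + 1) (hp : 2 ≤ p) :
    treewidth (guardedCNF (treeEdges k n)).primalGraph ≤ p := by
  classical
  set E := treeEdges k n with hE
  let I : Type := {s // s ∈ ternaryNodes n} ⊕ {e // e ∈ E}
  have hnode : ∀ e : {e // e ∈ E}, ∃ s : {s // s ∈ ternaryNodes n},
      e.1.1 ∈ treeBag k s.1 ∧ e.1.2 ∈ treeBag k s.1 := by
    rintro ⟨e, he⟩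
    obtain ⟨s, hs, h⟩ := mem_treeEdges.mp he
    exact ⟨⟨s, mem_ternaryNodes.mpr hs⟩, h⟩
  choose node hnode1 hnode2 using hnode
  have htail : ∀ s ∈ ternaryNodes n, s.tail ∈ ternaryNodes n := by
    intro s hs
    rw [mem_ternaryNodes] at hs ⊢
    rw [List.length_tail]; omega
  let parent : I → I := Sum.elim (fun s => .inl ⟨s.1.tail, htail _ s.2⟩) (fun e => .inl (node e))
  -- The value `n + 1` puts the clause leaves below all tree nodes.
  let depth : I → ℕ := Sum.elim (fun s => s.1.length) (fun _ => n + 1)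
  let root : I := .inl ⟨[], by simp⟩
  have hdepth : ∀ x : I, x ≠ root → depth (parent x) < depth x := by
    rintro (⟨s, hs⟩ | e) hx
    · have : s ≠ [] := by rintro rfl; exact hx rfl
      have := List.length_pos_iff.mpr this
      simp only [depth, parent, Sum.elim_inl, List.length_tail]
      omega
    · have := mem_ternaryNodes.mp (node e).2
      simp only [depth, parent, Sum.elim_inl, Sum.elim_inr]
      omega
  let names : I → Finset ℕ := Sum.elim (fun s => (treeBag k s.1).image vertexVar)
    (fun e => {vertexVar e.1.1, vertexVar e.1.2, guardVar e.1})
  have hclause : ∀ e : {e // e ∈ E}, ∀ x b, (x, b) ∈ guardedClause e.1 → x ∈ names (.inr e) := by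
    intro e x b h
    simp only [guardedClause, Finset.mem_insert, Finset.mem_singleton, Prod.mk.injEq] at h
    simp only [names, Sum.elim_inr, Finset.mem_insert, Finset.mem_singleton]
    tauto
  let D : TreeDecomposition (guardedCNF E).primalGraph :=
    { Idx := I
      fintypeIdx := inferInstance
      tree := parentGraph parent
      isTree := isTree_parentGraph root hdepth rfl
      bag := fun t => (names t).subtype (· ∈ (guardedCNF E).vars)
      union := by
        rintro ⟨x, hx⟩
        obtain ⟨e, he, h⟩ := mem_vars_guardedCNF.mp hx
        exact ⟨.inr ⟨e, he⟩, Finset.mem_subtype.mpr (by simpa [names] using h)⟩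
      containment := by
        rintro x y ⟨-, C, hC, ⟨b, hb⟩, ⟨b', hb'⟩⟩
        obtain ⟨e, he, rfl⟩ := Finset.mem_image.mp hC
        exact ⟨.inr ⟨e, he⟩, Finset.mem_subtype.mpr (hclause ⟨e, he⟩ _ _ hb),
          Finset.mem_subtype.mpr (hclause ⟨e, he⟩ _ _ hb')⟩
      connectedness := by
        rintro ⟨x, hx⟩
        obtain ⟨e, he, h⟩ := mem_vars_guardedCNF.mp hx
        have hset : {t : I | (⟨x, hx⟩ : (guardedCNF E).vars) ∈
            (names t).subtype (· ∈ (guardedCNF E).vars)} = {t | x ∈ names t} := by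
          ext t
          exact Finset.mem_subtype
        rw [hset]
        -- The tree nodes whose bags contain `u` are its own node and the children of that node;
        -- clause leaves with `u` hang below one of these. The node of `u` is thus the top.
        have hvertex : ∀ u : List (Fin 3) × Fin k, u.1.length ≤ n →
            ((parentGraph parent).induce {t | vertexVar u ∈ names t}).Connected := by
          intro u hu
          have hmem : ∀ s : {s // s ∈ ternaryNodes n},
              vertexVar u ∈ names (.inl s) ↔ u.1 = s.1 ∨ u.1 = s.1.tail := by
            intro s
            simp only [names, Sum.elim_inl]
            rw [vertexVar_injective.mem_finset_image, mem_treeBag]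
          refine connected_induce_parentGraph (depth := depth) _
            (.inl ⟨u.1, mem_ternaryNodes.mpr hu⟩) ((hmem _).mpr (.inl rfl)) ?_ ?_
          · rintro (⟨s, hs⟩ | e) hx hne
            · refine hdepth _ ?_
              rintro h
              have hs0 : s = [] := congrArg Subtype.val (Sum.inl_injective h)
              subst hs0
              have hu0 : u.1 = [] := by simpa using (hmem ⟨[], hs⟩).mp hx
              exact hne (congrArg Sum.inl (Subtype.ext hu0.symm))
            · exact hdepth _ Sum.inr_ne_inl
          · rintro (⟨s, hs⟩ | e) hx hne
            · rcases (hmem _).mp hx with h | h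
              · exact absurd (congrArg Sum.inl (Subtype.ext h.symm)) hne
              · exact (hmem _).mpr (.inl h)
            · refine (hmem (node e)).mpr ?_
              simp only [Set.mem_ofPred_eq, names, Sum.elim_inr, Finset.mem_insert,
                Finset.mem_singleton] at hx
              rcases hx with h | h | h
              · rw [vertexVar_injective h]; exact mem_treeBag.mp (hnode1 e)
              · rw [vertexVar_injective h]; exact mem_treeBag.mp (hnode2 e)
              · exact absurd h (vertexVar_ne_guardVar _ _)
        rcases h with rfl | rfl | rfl
        · exact hvertex _ (length_fst_le_of_mem_treeEdges he)
        · exact hvertex _ (length_snd_le_of_mem_treeEdges he)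
        · have honly : ∀ t : I, guardVar e ∈ names t → t = .inr ⟨e, he⟩ := by
            rintro (s | e') ht
            · simp only [names, Sum.elim_inl, Finset.mem_image] at ht
              obtain ⟨u, -, hu⟩ := ht
              exact absurd hu (vertexVar_ne_guardVar _ _)
            · simp only [names, Sum.elim_inr, Finset.mem_insert, Finset.mem_singleton] at ht
              rcases ht with h | h | h
              · exact absurd h.symm (vertexVar_ne_guardVar _ _)
              · exact absurd h.symm (vertexVar_ne_guardVar _ _)
              · exact congrArg Sum.inr (Subtype.ext (guardVar_injective h).symm)
          exact connected_induce_parentGraph (depth := depth) _ (.inr ⟨e, he⟩)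
            (by simp [names]) (fun t ht hne => absurd (honly t ht) hne)
            (fun t ht hne => absurd (honly t ht) hne) }
  refine treewidth_le_of_card_bag_le D fun t => (card_finsetSubtype_le _ _).trans ?_
  rcases t with s | e
  · exact Finset.card_image_le.trans ((card_treeBag_le k s.1).trans hkp)
  · exact Finset.card_le_three.trans (by omega)

/-- The starting levels multiply the size of the tree by a factor linear in `H`; enlarging the base
from `3` to `4` absorbs it. -/
theorem succ_mul_three_pow_le (H : ℕ) : (H + 1) * 3 ^ H ≤ 3 * 4 ^ H := by
  induction H with
  | zero => norm_num
  | succ H ih =>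
    have h : 3 ^ H ≤ 4 ^ H := Nat.pow_le_pow_left (by norm_num) H
    calc (H + 1 + 1) * 3 ^ (H + 1) = 3 * ((H + 1) * 3 ^ H) + 3 * 3 ^ H := by ring
      _ ≤ 3 * (3 * 4 ^ H) + 3 * 4 ^ H := by gcongr
      _ = 3 * 4 ^ (H + 1) := by ring

/-- The guarded CNF of the blown-up tree in which every variable order has a cut of size `k * H`. -/
def hardCNF (k H : ℕ) : CNF ℕ :=
  guardedCNF (treeEdges k (H + (Nat.log 3 (k * H + 1) + 1)))

theorem le_numVars_hardCNF {k : ℕ} (hk : 0 < k) (H : ℕ) : H ≤ (hardCNF k H).numVars := by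
  refine le_trans ?_ ((pow_le_card_treeEdges hk _).trans (card_le_numVars_guardedCNF _))
  exact (Nat.le_add_right _ _).trans (Nat.lt_pow_self (by norm_num)).le

theorem numVars_hardCNF_le {k : ℕ} (hk : 0 < k) (H : ℕ) :
    (hardCNF k H).numVars ≤ 216 * k ^ 3 * 4 ^ H := by
  have hlog : 3 ^ Nat.log 3 (k * H + 1) ≤ k * H + 1 := Nat.pow_log_le_self 3 (by omega)
  have hkH : k * H + 1 ≤ k * (H + 1) := by rw [mul_add]; omega
  calc (hardCNF k H).numVars
      ≤ 3 * (2 * 3 ^ (H + (Nat.log 3 (k * H + 1) + 1)) * (2 * k * (2 * k))) :=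
        (numVars_guardedCNF_le _).trans (Nat.mul_le_mul_left 3 (card_treeEdges_le k _))
    _ = 72 * k ^ 2 * 3 ^ H * 3 ^ Nat.log 3 (k * H + 1) := by ring
    _ ≤ 72 * k ^ 2 * 3 ^ H * (k * (H + 1)) := Nat.mul_le_mul_left _ (hlog.trans hkH)
    _ = 72 * k ^ 3 * ((H + 1) * 3 ^ H) := by ring
    _ ≤ 72 * k ^ 3 * (3 * 4 ^ H) := Nat.mul_le_mul_left _ (succ_mul_three_pow_le H)
    _ = 216 * k ^ 3 * 4 ^ H := by ring

theorem two_pow_le_obddSize_hardCNF {k : ℕ} (hk : 0 < k) (H : ℕ) :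
    2 ^ (k * H) ≤ (hardCNF k H).obddSize := by
  refine two_pow_le_obddSize_guardedCNF _ fun ord hord => ?_
  refine exists_isCrossMatching_treeEdges hk
    (Nat.lt_pow_succ_log_self (by norm_num) _).le (hord.mono fun u hu => ?_)
  -- The loops in `treeEdges` make every vertex of the tree an endpoint.
  exact ⟨(u, u), mem_treeEdges.mpr ⟨u.1, hu, by simp, by simp⟩, .inl rfl⟩

theorem rpow_numVars_hardCNF_le {p k : ℕ} (hk : 0 < k) (hpk : p ≤ 2 * k) (H : ℕ) :
    ((hardCNF k H).numVars : ℝ) ^ ((p : ℝ) / 4) ≤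
      (216 * (k : ℝ) ^ 3) ^ ((p : ℝ) / 4) * ((hardCNF k H).obddSize : ℝ) := by
  have h1 : ((hardCNF k H).numVars : ℝ) ≤ 216 * (k : ℝ) ^ 3 * 4 ^ H := by
    exact_mod_cast numVars_hardCNF_le hk H
  have h2 : (2 : ℝ) ^ (k * H) ≤ ((hardCNF k H).obddSize : ℝ) := by
    exact_mod_cast two_pow_le_obddSize_hardCNF hk H
  have hexp : (p : ℝ) / 4 ≤ (k : ℝ) / 2 := by
    have : (p : ℝ) ≤ 2 * k := by exact_mod_cast hpk
    linarith
  have h3 : ((4 : ℝ) ^ H) ^ ((k : ℝ) / 2) = 2 ^ (k * H) := by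
    rw [show (4 : ℝ) ^ H = 2 ^ (2 * H) by rw [pow_mul]; norm_num, ← Real.rpow_natCast,
      ← Real.rpow_mul (by norm_num), ← Real.rpow_natCast]
    congr 1
    push_cast
    ring
  calc ((hardCNF k H).numVars : ℝ) ^ ((p : ℝ) / 4)
      ≤ (216 * (k : ℝ) ^ 3 * 4 ^ H) ^ ((p : ℝ) / 4) :=
        Real.rpow_le_rpow (by positivity) h1 (by positivity)
    _ = (216 * (k : ℝ) ^ 3) ^ ((p : ℝ) / 4) * ((4 : ℝ) ^ H) ^ ((p : ℝ) / 4) :=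
        Real.mul_rpow (by positivity) (by positivity)
    _ ≤ (216 * (k : ℝ) ^ 3) ^ ((p : ℝ) / 4) * ((4 : ℝ) ^ H) ^ ((k : ℝ) / 2) := by
        gcongr
        exact one_le_pow₀ (by norm_num)
    _ ≤ _ := by rw [h3]; gcongr

/-! ### Conjunctions of variables -/

/-- The CNF with the unit clauses `0, …, n`. -/
def unitCNF (n : ℕ) : CNF ℕ where
  clauses := (Finset.range (n + 1)).image fun i => {(i, true)}
  consistent := by
    intro C hC x hx
    obtain ⟨i, -, rfl⟩ := Finset.mem_image.mp hC
    simp at hx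

theorem vars_unitCNF (n : ℕ) : (unitCNF n).vars = Finset.range (n + 1) := by
  ext x
  simp [CNF.vars, unitCNF]

theorem numVars_unitCNF (n : ℕ) : (unitCNF n).numVars = n + 1 := by
  simp [CNF.numVars, vars_unitCNF]

theorem sat_unitCNF_iff (n : ℕ) (a : (unitCNF n).vars → Bool) :
    (unitCNF n).Sat a ↔ ∀ x, a x = true := by
  simp only [CNF.Sat]
  constructor
  · rintro h ⟨x, hx⟩
    obtain ⟨⟨y, hy⟩, hyx⟩ := h {(x, true)}
      (Finset.mem_image_of_mem _ (by rwa [vars_unitCNF] at hx))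
    simp only [Finset.mem_singleton, Prod.mk.injEq] at hyx
    obtain ⟨rfl, h⟩ := hyx
    exact h
  · intro h C hC
    obtain ⟨i, hi, rfl⟩ := Finset.mem_image.mp hC
    exact ⟨⟨i, by rwa [vars_unitCNF]⟩, by simp [h]⟩

theorem treewidth_unitCNF_le (n : ℕ) : treewidth (unitCNF n).primalGraph ≤ 1 := by
  classical
  let root : (unitCNF n).vars := ⟨0, by simp [vars_unitCNF]⟩
  let D : TreeDecomposition (unitCNF n).primalGraph :=
    { Idx := (unitCNF n).vars
      fintypeIdx := inferInstance
      tree := parentGraph fun _ => root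
      isTree := isTree_parentGraph (depth := fun x => if x = root then 0 else 1) root
        (fun x hx => by simp [hx]) rfl
      bag := fun x => {x}
      union := fun x => ⟨x, Finset.mem_singleton_self x⟩
      containment := by
        rintro x y ⟨hne, C, hC, ⟨b, hb⟩, ⟨b', hb'⟩⟩
        obtain ⟨i, -, rfl⟩ := Finset.mem_image.mp hC
        simp only [Finset.mem_singleton, Prod.mk.injEq] at hb hb'
        exact absurd (Subtype.ext (hb.1.trans hb'.1.symm)) hne
      connectedness := fun x =>
        connected_induce_parentGraph (depth := fun _ => 0) _ x (Finset.mem_singleton_self x)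
          (fun y hy hne => absurd (Finset.mem_singleton.mp hy).symm hne)
          (fun y hy hne => absurd (Finset.mem_singleton.mp hy).symm hne) }
  exact treewidth_le_of_card_bag_le D fun t => (Finset.card_singleton t).trans_le (by norm_num)

theorem numVars_le_obddSize_unitCNF (n : ℕ) : (unitCNF n).numVars ≤ (unitCNF n).obddSize := by
  classical
  have hne : {s | ∃ Z : OBDD (unitCNF n).vars, (unitCNF n).ComputedBy Z ∧ Z.size = s}.Nonempty :=
    let ⟨Z, hZ⟩ := (unitCNF n).exists_computedBy
    ⟨_, Z, hZ, rfl⟩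
  obtain ⟨Z, hZ, hsize⟩ := Nat.sInf_mem hne
  change _ ≤ sInf _
  rw [← hsize]
  -- Switching `x` alone to false falsifies the conjunction, so every variable must be read.
  have hlabel : Function.Surjective Z.label := fun x =>
    Z.exists_label_eq x (a := fun _ => true) (a' := fun y => decide (y ≠ x))
      (fun y hy => by simp [hy])
      ((hZ _).mpr ((sat_unitCNF_iff n _).mpr fun _ => rfl))
      fun h => by simpa using (sat_unitCNF_iff n _).mp ((hZ _).mp h) x
  have := Z.finiteNode
  have hle := Nat.card_le_card_of_surjective _ hlabel
  rw [Nat.card_eq_fintype_card, Fintype.card_coe] at hle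
  exact hle.trans (Nat.le_add_right _ 2)

/-! ### The lower bound -/

theorem exists_hard_sequence {p : ℕ} (hp : 1 ≤ p) : ∃ c : ℝ, 0 < c ∧ ∃ F : ℕ → CNF ℕ,
    StrictMono (fun i => (F i).numVars) ∧ (∀ i, treewidth (F i).primalGraph ≤ p) ∧
    ∀ i, c * ((F i).numVars : ℝ) ^ ((p : ℝ) / 4) ≤ ((F i).obddSize : ℝ) := by
  -- Guarded clauses may have three variables, which treewidth `1` does not allow; hence the
  -- separate family for `p = 1`.
  rcases hp.eq_or_lt with rfl | hp
  · refine ⟨1, one_pos, unitCNF, fun i j hij => ?_, treewidth_unitCNF_le, fun i => ?_⟩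
    · simpa only [numVars_unitCNF, Nat.add_lt_add_iff_right] using hij
    · have h1 : (1 : ℝ) ≤ ((unitCNF i).numVars : ℝ) := by
        rw [numVars_unitCNF]; simp
      have h2 : ((unitCNF i).numVars : ℝ) ≤ ((unitCNF i).obddSize : ℝ) := by
        exact_mod_cast numVars_le_obddSize_unitCNF i
      rw [one_mul]
      refine le_trans ?_ h2
      exact (Real.rpow_le_rpow_of_exponent_le h1 (by norm_num)).trans_eq (Real.rpow_one _)
  -- This rounding gives both `2 * k ≤ p + 1`, for the treewidth, and `p ≤ 2 * k`, for the exponent.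
  · set k := (p + 1) / 2 with hkdef
    have hk : 0 < k := by omega
    have htend : Filter.Tendsto (fun H => (hardCNF k H).numVars) Filter.atTop Filter.atTop :=
      Filter.tendsto_atTop_mono (le_numVars_hardCNF hk) Filter.tendsto_id
    obtain ⟨φ, -, hφ⟩ := Filter.strictMono_subseq_of_tendsto_atTop htend
    have hc : (0 : ℝ) < (216 * (k : ℝ) ^ 3) ^ ((p : ℝ) / 4) := by positivity
    refine ⟨_, inv_pos.mpr hc, fun i => hardCNF k (φ i), hφ,
      fun i => treewidth_guardedCNF_treeEdges_le (by omega) (by omega), fun i => ?_⟩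
    rw [inv_mul_le_iff₀ hc]
    exact rpow_numVars_hardCNF_le hk (by omega) (φ i)

theorem mainTheorem2 :
    (∃ f : ℕ → ℝ, (∀ p, 0 < f p) ∧
      ∀ p : ℕ, 1 ≤ p → ∃ F : ℕ → CNF ℕ,
        StrictMono (fun i => (F i).numVars) ∧
        (∀ i, treewidth (F i).primalGraph ≤ p) ∧
        (∀ i, f p * ((F i).numVars : ℝ) ^ ((p : ℝ) / 4) ≤ ((F i).obddSize : ℝ)) ∧
        (fun i => ((F i).numVars : ℝ) ^ ((p : ℝ) / 4))
          =O[Filter.atTop] (fun i => ((F i).obddSize : ℝ))) ∧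
    ¬ ∃ (g : ℕ → ℝ) (c : ℝ), ∀ F : CNF ℕ, 1 ≤ F.numVars →
        (F.obddSize : ℝ) ≤ g (treewidth F.primalGraph) * (F.numVars : ℝ) ^ c := by
  constructor
  · have h : ∀ p : ℕ, ∃ c : ℝ, 0 < c ∧ (1 ≤ p → ∃ F : ℕ → CNF ℕ,
        StrictMono (fun i => (F i).numVars) ∧ (∀ i, treewidth (F i).primalGraph ≤ p) ∧
        ∀ i, c * ((F i).numVars : ℝ) ^ ((p : ℝ) / 4) ≤ ((F i).obddSize : ℝ)) := by
      intro p
      by_cases hp : 1 ≤ p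
      · obtain ⟨c, hc, hF⟩ := exists_hard_sequence hp
        exact ⟨c, hc, fun _ => hF⟩
      · exact ⟨1, one_pos, fun h => absurd h hp⟩
    choose f hf hF using h
    refine ⟨f, hf, fun p hp => ?_⟩
    obtain ⟨F, hmono, htw, hsize⟩ := hF p hp
    refine ⟨F, hmono, htw, hsize, Asymptotics.IsBigO.of_bound (f p)⁻¹ (.of_forall fun i => ?_)⟩
    rw [Real.norm_of_nonneg (by positivity), Real.norm_of_nonneg (by positivity),
      ← div_eq_inv_mul, le_div_iff₀' (hf p)]
    exact hsize i
  · rintro ⟨g, c, hg⟩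
    obtain ⟨q, hq⟩ := exists_nat_gt (4 * c)
    obtain ⟨d, hd, F, hmono, htw, hsize⟩ := exists_hard_sequence (p := q + 1) (by omega)
    -- The treewidths are only bounded by `q + 1` and may vary with `i`, so `g` is bounded over all
    -- values up to `q + 1`.
    obtain ⟨G, hG⟩ : ∃ G, ∀ w ≤ q + 1, g w ≤ G := by
      obtain ⟨G, hG⟩ := ((Set.finite_Iic (q + 1)).image g).bddAbove
      exact ⟨G, fun w hw => hG (Set.mem_image_of_mem g hw)⟩
    have hexp : 0 < ((q + 1 : ℕ) : ℝ) / 4 - c := by push_cast; linarith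
    have htend : Filter.Tendsto (fun i => ((F i).numVars : ℝ) ^ (((q + 1 : ℕ) : ℝ) / 4 - c))
        Filter.atTop Filter.atTop :=
      (tendsto_rpow_atTop hexp).comp (tendsto_natCast_atTop_atTop.comp hmono.tendsto_atTop)
    obtain ⟨i, hi, hi1⟩ := ((htend.eventually_gt_atTop (G / d)).and
      (hmono.tendsto_atTop.eventually_ge_atTop 1)).exists
    have hpos : (0 : ℝ) < ((F i).numVars : ℝ) := by exact_mod_cast hi1
    have hup := (hsize i).trans ((hg (F i) hi1).trans
      (mul_le_mul_of_nonneg_right (hG _ (htw i)) (by positivity)))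
    rw [Real.rpow_sub hpos, div_lt_div_iff₀ hd (by positivity)] at hi
    linarith
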